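/- Let $F_0=0$, $F_1=1$ and $F_k=F_{k-1}+F_{k-2}$ for $k\ge 2$ be the Fibonacci numbers. Every positive integer $n$ has a unique Zeckendorf expansion $n=\sum_{i\ge 2}\varepsilon_i(n)F_i$ with $\varepsilon_i(n)\in\{0,1\}$ and no two consecutive digits equal to $1$. Let $s_\varphi(n)=\sum_{i\ge 2}\varepsilon_i(n)$ be the Zeckendorf sum-of-digits function, with $s_\varphi(0)=0$. Let $p,q$ be integers with $q>p\ge 1$. Then there exists $\eta>0$ (depending on $p$ and $q$) such that \[ \sum_{1\le n<N}(-1)^{s_\varphi(pn)+s_\varphi(qn)}=O\bigl(N^{1-\eta}\bigr)\qquad(N\to\infty), \] where the implied constant may depend on $p$ and $q$. -/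

import Mathlib

/-- The Zeckendorf sum-of-digits function `s_φ`. Mathlib's `Nat.zeckendorf n` is the list of those
indices `i ≥ 2` for which the digit `ε_i` of `F_i` in the Zeckendorf expansion of `n` is `1`
(no two of them consecutive), so that the sum of the digits `ε_i ∈ {0, 1}` is its length. -/
def zeckendorfDigitSum (n : ℕ) : ℕ := (Nat.zeckendorf n).length

theorem zeckendorfDigitSum_zero : zeckendorfDigitSum 0 = 0 := by
  simp [zeckendorfDigitSum]

/-- Any Zeckendorf representation computes `s_φ`. -/
theorem zeckendorfDigitSum_eq_length {l : List ℕ} (hl : l.IsZeckendorfRep) :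
    zeckendorfDigitSum (l.map Nat.fib).sum = l.length := by
  rw [zeckendorfDigitSum, Nat.zeckendorf_sum_fib hl]

/-! The sum over a Fibonacci-length block splits, by the Fibonacci recursion, into shorter blocks.
Suppose some `w` has `s_φ(pw) + s_φ(qw)` odd and its digit pattern, moved up into a long run of
zeros, is multiplied by `p` and `q` without interacting with the digits around it. Adding this
pattern then reverses the sign, so in every long block two of the shorter blocks cancel exactly
(`exists_contraction`). Losing a fixed number of blocks at each step lowers the growth rate from `φ`
to `φ ^ θ` with `θ < 1`, and a greedy decomposition carries the bound to arbitrary `N`.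

Interactions are controlled by the conjugate `∑ ψ ^ i` over the digits of `n`: the window in which
it lies determines the lowest digit (`sum_pow_mem_window`). The conjugate is multiplied by `r` along
with `n` as long as the product stays in `window 2`.

To find `w` (`exists_isFlip`), take `a`, `b` such that `pa` and `pb` add without carry, while adding
`qa` and `qb` starts a chain of carries that changes the parity of the digit sum. The total parity
over `a`, `b`, `a + b` is then odd, so one of the three serves. -/

open Finset
open scoped goldenRatio

namespace Zeckendorf

/-! ### Sparse index sets and uniqueness of the expansion -/

/-- A finite set of indices that are at least `2` and pairwise non-consecutive. -/
def IsSparse (s : Finset ℕ) : Prop := ∀ i ∈ s, 2 ≤ i ∧ i + 1 ∉ s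

/-- The set of indices of the non-zero Zeckendorf digits of `n`. -/
def indices (n : ℕ) : Finset ℕ := (Nat.zeckendorf n).toFinset

theorem IsSparse.mono {s t : Finset ℕ} (ht : IsSparse t) (hst : s ⊆ t) : IsSparse s :=
  fun i hi => ⟨(ht i (hst hi)).1, fun h => (ht i (hst hi)).2 (hst h)⟩

theorem IsSparse.union {s t : Finset ℕ} {m : ℕ} (hs : IsSparse s) (ht : IsSparse t)
    (hsm : ∀ i ∈ s, m ≤ i) (htm : ∀ i ∈ t, i + 2 ≤ m) : IsSparse (s ∪ t) := by
  intro i hi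
  simp only [mem_union] at hi ⊢
  rcases hi with hi | hi
  · refine ⟨(hs i hi).1, fun h => h.elim (hs i hi).2 fun h => ?_⟩
    have := hsm i hi; have := htm _ h; omega
  · refine ⟨(ht i hi).1, fun h => h.elim (fun h => ?_) (ht i hi).2⟩
    have := htm i hi; have := hsm _ h; omega

theorem pairwise_zeckendorf (n : ℕ) :
    (Nat.zeckendorf n).Pairwise (fun a b => b + 2 ≤ a) ∧ ∀ i ∈ Nat.zeckendorf n, 2 ≤ i := by
  have h := Nat.isZeckendorfRep_zeckendorf n
  have : Trans (fun a b : ℕ => b + 2 ≤ a) (fun a b => b + 2 ≤ a) (fun a b => b + 2 ≤ a) :=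
    ⟨fun h1 h2 => by omega⟩
  rw [List.IsZeckendorfRep, List.isChain_iff_pairwise, List.pairwise_append] at h
  exact ⟨h.1, fun i hi => by simpa using h.2.2 i hi 0 (by simp)⟩

theorem nodup_zeckendorf (n : ℕ) : (Nat.zeckendorf n).Nodup :=
  (pairwise_zeckendorf n).1.imp (fun h => by omega)

theorem isSparse_indices (n : ℕ) : IsSparse (indices n) := by
  intro i hi
  obtain ⟨h1, h2⟩ := pairwise_zeckendorf n
  simp only [indices, List.mem_toFinset] at hi ⊢
  refine ⟨h2 i hi, fun h => ?_⟩
  have : Std.Symm (fun a b : ℕ => a ≠ b + 1 ∧ b ≠ a + 1) := ⟨fun _ _ h => ⟨h.2, h.1⟩⟩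
  have key : (Nat.zeckendorf n).Pairwise (fun a b => a ≠ b + 1 ∧ b ≠ a + 1) :=
    h1.imp (fun h => by omega)
  have h3 := key.forall_of_forall (fun x _ => by omega) h hi
  omega

theorem sum_indices (n : ℕ) : ∑ i ∈ indices n, Nat.fib i = n := by
  rw [indices, List.sum_toFinset _ (nodup_zeckendorf n), Nat.sum_zeckendorf_fib]

theorem card_indices (n : ℕ) : (indices n).card = zeckendorfDigitSum n :=
  List.toFinset_card_of_nodup (nodup_zeckendorf n)

theorem indices_sum {s : Finset ℕ} (hs : IsSparse s) : indices (∑ i ∈ s, Nat.fib i) = s := by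
  have hrep : (s.sort (· ≥ ·)).IsZeckendorfRep := by
    have : Trans (fun a b : ℕ => b + 2 ≤ a) (fun a b => b + 2 ≤ a) (fun a b => b + 2 ≤ a) :=
      ⟨fun h1 h2 => by omega⟩
    rw [List.IsZeckendorfRep, List.isChain_iff_pairwise, List.pairwise_append]
    refine ⟨?_, by simp, fun a ha b hb => ?_⟩
    · have h1 := s.pairwise_sort (· ≥ ·)
      have h2 := s.sort_nodup (· ≥ ·)
      refine List.Pairwise.imp_of_mem ?_ (h1.and h2)
      intro a b ha hb hab
      have h3 := (hs b ((mem_sort _).1 hb)).2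
      have h4 : a ≠ b + 1 := fun h => h3 (h ▸ (mem_sort _).1 ha)
      have := hab.1; have := hab.2; omega
    · have := (hs a ((mem_sort _).1 ha)).1
      simp only [List.mem_singleton] at hb
      omega
  have hsum : ((s.sort (· ≥ ·)).map Nat.fib).sum = ∑ i ∈ s, Nat.fib i := by
    rw [← List.sum_toFinset _ (s.sort_nodup _), sort_toFinset]
  rw [indices, ← hsum, Nat.zeckendorf_sum_fib hrep, sort_toFinset]

theorem digitSum_sum {s : Finset ℕ} (hs : IsSparse s) :
    zeckendorfDigitSum (∑ i ∈ s, Nat.fib i) = s.card := by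
  rw [← card_indices, indices_sum hs]

theorem lt_of_mem_indices {n k i : ℕ} (hn : n < Nat.fib k) (hi : i ∈ indices n) : i < k := by
  by_contra h
  have h1 : Nat.fib i ≤ n := by
    conv_rhs => rw [← sum_indices n]
    exact single_le_sum (f := Nat.fib) (fun _ _ => Nat.zero_le _) hi
  have := Nat.fib_mono (not_lt.1 h)
  omega

theorem indices_fib {k : ℕ} (hk : 2 ≤ k) : indices (Nat.fib k) = {k} := by
  have : IsSparse {k} := fun i hi => by simp at hi ⊢; omega
  simpa using indices_sum this

theorem indices_add {u v m : ℕ} (hu : ∀ i ∈ indices u, m + 1 ≤ i) (hv : v < Nat.fib m) :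
    indices (u + v) = indices u ∪ indices v ∧
      zeckendorfDigitSum (u + v) = zeckendorfDigitSum u + zeckendorfDigitSum v := by
  have hv' : ∀ i ∈ indices v, i + 2 ≤ m + 1 := fun i hi => by
    have := lt_of_mem_indices hv hi; omega
  have hd : Disjoint (indices u) (indices v) := disjoint_left.2 fun i h1 h2 => by
    have := hu i h1; have := hv' i h2; omega
  have h1 : indices (u + v) = indices u ∪ indices v := by
    rw [← indices_sum ((isSparse_indices u).union (isSparse_indices v) hu hv'),
      sum_union hd, sum_indices, sum_indices]
  exact ⟨h1, by rw [← card_indices, h1, card_union_of_disjoint hd, card_indices, card_indices]⟩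

/-! ### Digit shifts, conjugates and windows -/

/-- The number whose Zeckendorf digits are those of `n`, moved up by `t` places. -/
def shift (t n : ℕ) : ℕ := ∑ i ∈ indices n, Nat.fib (i + t)

/-- The sum of the powers of `ψ` selected by the Zeckendorf digits of `n`. -/
noncomputable def conj (n : ℕ) : ℝ := ∑ i ∈ indices n, ψ ^ i

theorem indices_shift (t n : ℕ) : indices (shift t n) = (indices n).map (addRightEmbedding t) := by
  rw [shift, ← indices_sum (s := (indices n).map (addRightEmbedding t)) _]
  · simp
  · intro i hi
    simp only [mem_map, addRightEmbedding_apply] at hi ⊢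
    obtain ⟨j, hj, rfl⟩ := hi
    have := isSparse_indices n j hj
    refine ⟨by omega, ?_⟩
    rintro ⟨x, hx, hx'⟩
    obtain rfl : x = j + 1 := by omega
    exact this.2 hx

theorem digitSum_shift (t n : ℕ) : zeckendorfDigitSum (shift t n) = zeckendorfDigitSum n := by
  rw [← card_indices, indices_shift, card_map, card_indices]

theorem shift_succ (t n : ℕ) : shift (t + 1) n = Nat.fib t * n + Nat.fib (t + 1) * shift 1 n := by
  have h : Nat.fib t * n = ∑ i ∈ indices n, Nat.fib t * Nat.fib i := by
    rw [← mul_sum, sum_indices]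
  rw [h, shift, shift, mul_sum, ← sum_add_distrib]
  refine sum_congr rfl fun i _ => ?_
  rw [← Nat.fib_add]
  congr 1
  omega

theorem conj_eq (n : ℕ) : conj n = shift 1 n - φ * n := by
  have h : φ * n = ∑ i ∈ indices n, φ * Nat.fib i := by
    rw [← mul_sum, ← Nat.cast_sum, sum_indices]
  rw [h, shift, conj, Nat.cast_sum, ← sum_sub_distrib]
  exact sum_congr rfl fun i _ => (Real.fib_succ_sub_goldenRatio_mul_fib i).symm

/-- The interval of those `x` that occur as values of finite sparse sums of powers `ψ ^ i` with
`m ≤ i`. -/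
def window (m : ℕ) : Set ℝ := {x | -1 < (-φ) ^ m * x ∧ (-φ) ^ m * x < φ}

theorem window_succ_subset (m : ℕ) : window (m + 1) ⊆ window m := by
  rintro x ⟨h1, h2⟩
  rw [pow_succ', mul_assoc] at h1 h2
  have := Real.one_lt_goldenRatio
  have := Real.goldenRatio_sq
  constructor <;> nlinarith

theorem window_anti {m n : ℕ} (h : m ≤ n) : window n ⊆ window m :=
  antitone_nat_of_succ_le (f := window) window_succ_subset h

theorem neg_goldenRatio_pow_mul (m : ℕ) : (-φ) ^ m * ψ ^ m = 1 := by
  rw [← mul_pow, neg_mul, Real.goldenRatio_mul_goldenConj]; simp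

/-- After scaling by `(-φ) ^ a`, `window (a + 2)` is `(-1/φ², 1/φ)`. Its translate by `1` is `(1/φ,
φ)`, which lies inside `window a = (-1, φ)` and misses `window (a + 1) = (-1, 1/φ)`. -/
theorem pow_add_mem_window_diff {a : ℕ} {x : ℝ} (hx : x ∈ window (a + 2)) :
    ψ ^ a + x ∈ window a ∧ ψ ^ a + x ∉ window (a + 1) := by
  obtain ⟨h1, h2⟩ := hx
  have e := neg_goldenRatio_pow_mul a
  have h3 := Real.one_lt_goldenRatio
  have h4 := Real.goldenRatio_sq
  have e2 : (-φ) ^ (a + 2) * x = (φ + 1) * ((-φ) ^ a * x) := by rw [← h4]; ring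
  rw [e2] at h1 h2
  simp only [window, Set.mem_ofPred_eq, mul_add, e, pow_succ']
  rw [mul_assoc (-φ), e, mul_assoc]
  refine ⟨⟨by nlinarith, by nlinarith⟩, fun h => ?_⟩
  nlinarith [h.1]

/-- The least index decides: the larger ones contribute an element of `window (a + 2)`, so the whole
sum lies in `window a` but not in `window (a + 1)`, and windows are nested. -/
theorem sum_pow_mem_window {s : Finset ℕ} : ∀ {m : ℕ}, IsSparse s →
    ((∑ i ∈ s, ψ ^ i) ∈ window m ↔ ∀ i ∈ s, m ≤ i) := by
  induction s using Finset.induction_on_min with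
  | empty =>
    intro m _
    simpa [window] using Real.goldenRatio_pos
  | insert a s has ih =>
    intro m hs
    have ha : a ∉ s := fun h => lt_irrefl _ (has a h)
    have hs' := hs.mono (subset_insert a s)
    have hx : (∑ i ∈ s, ψ ^ i) ∈ window (a + 2) := by
      refine (ih hs').2 fun i hi => ?_
      have h1 := has i hi
      have h2 : i ≠ a + 1 := fun h => (hs a (mem_insert_self _ _)).2 (h ▸ mem_insert_of_mem hi)
      omega
    obtain ⟨h1, h2⟩ := pow_add_mem_window_diff hx
    rw [sum_insert ha]
    constructor
    · intro h i hi
      have hma : m ≤ a := by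
        by_contra hlt
        exact h2 (window_anti (by omega) h)
      rcases mem_insert.1 hi with rfl | hi
      · exact hma
      · exact hma.trans (has i hi).le
    · intro h
      exact window_anti (h a (mem_insert_self _ _)) h1

theorem conj_mem_window {n m : ℕ} : conj n ∈ window m ↔ ∀ i ∈ indices n, m ≤ i :=
  sum_pow_mem_window (isSparse_indices n)

theorem conj_mem_window_two (n : ℕ) : conj n ∈ window 2 :=
  conj_mem_window.2 fun i hi => (isSparse_indices n i hi).1

/-- `window 2` is an open interval of length `1/φ² + 1/φ = 1`, so it contains `t - φ n` for at most
one integer `t`; `shift 1 n` is such an integer. -/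
theorem shift_one_eq_of_mem_window {n t : ℕ} (h : (t : ℝ) - φ * n ∈ window 2) :
    shift 1 n = t := by
  have h2 := conj_mem_window_two n
  rw [conj_eq] at h2
  have h3 := Real.one_lt_goldenRatio
  have h4 := Real.goldenRatio_sq
  simp only [window, Set.mem_ofPred_eq, neg_sq, h4] at h h2
  have h5 : (shift 1 n : ℝ) < t + 1 := by nlinarith
  have h6 : (t : ℝ) < shift 1 n + 1 := by nlinarith
  norm_cast at h5 h6
  omega

theorem mul_mem_window {m : ℕ} {x c : ℝ} (hx : x ∈ window m) (h0 : 0 ≤ c) (h1 : c ≤ 1) :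
    c * x ∈ window m := by
  obtain ⟨h2, h3⟩ := hx
  have h4 := Real.goldenRatio_pos
  simp only [window, Set.mem_ofPred_eq]
  rw [mul_left_comm]
  rcases le_total 0 ((-φ) ^ m * x) with h5 | h5 <;> constructor <;> nlinarith

theorem shift_one_mul {n r : ℕ} (h : r * conj n ∈ window 2) :
    shift 1 (r * n) = r * shift 1 n ∧ conj (r * n) = r * conj n := by
  have h1 : shift 1 (r * n) = r * shift 1 n := by
    apply shift_one_eq_of_mem_window
    rw [conj_eq] at h
    convert h using 1
    push_cast; ring
  refine ⟨h1, ?_⟩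
  rw [conj_eq, h1, conj_eq]
  push_cast; ring

theorem shift_mul {n r : ℕ} (t : ℕ) (h : r * conj n ∈ window 2) :
    shift (t + 1) (r * n) = r * shift (t + 1) n := by
  rw [shift_succ, shift_succ t n, (shift_one_mul h).1]; ring

/-! ### Spread of digits under multiplication by a bounded factor -/

theorem le_goldenRatio_pow (q : ℕ) : (q : ℝ) + 1 ≤ φ ^ (2 * q) := by
  rw [pow_mul, Real.goldenRatio_sq]
  have h := one_add_mul_le_pow (a := φ) (by linarith [Real.goldenRatio_pos]) q
  rw [add_comm φ 1]
  nlinarith [Real.one_lt_goldenRatio, (Nat.cast_nonneg q : (0 : ℝ) ≤ q)]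

theorem mul_fib_le (c j : ℕ) : c * Nat.fib j ≤ Nat.fib (j + 2 * c) := by
  induction c with
  | zero => simp
  | succ c ih =>
    have h1 : Nat.fib (j + 2 * (c + 1)) = Nat.fib (j + 2 * c) + Nat.fib (j + 2 * c + 1) :=
      Nat.fib_add_two
    have h2 : Nat.fib j ≤ Nat.fib (j + 2 * c + 1) := Nat.fib_mono (by omega)
    rw [h1]; linarith

/-- Raising the lowest digit by `2 * q + 1` places shrinks the conjugate by `φ ^ (2 * q + 1)`, which
outweighs a factor `r ≤ q`. -/
theorem mul_indices_ge {n m q r : ℕ} (hm : 2 ≤ m) (hr : r ≤ q)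
    (hn : ∀ i ∈ indices n, m + 2 * q + 1 ≤ i) : ∀ i ∈ indices (r * n), m ≤ i := by
  have h1 := conj_mem_window.2 hn
  have hx : (r : ℝ) * conj n ∈ window m := by
    obtain ⟨h2, h3⟩ := h1
    have e : (-φ) ^ (m + 2 * q + 1) * conj n = -φ * (φ ^ (2 * q) * ((-φ) ^ m * conj n)) := by
      rw [pow_succ, pow_add, (even_two_mul q).neg_pow]; ring
    rw [e] at h2 h3
    have h4 := le_goldenRatio_pow q
    have h5 : (r : ℝ) ≤ q := by exact_mod_cast hr
    have h6 := Real.one_lt_goldenRatio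
    set y := (-φ) ^ m * conj n
    set z := φ ^ (2 * q)
    have h0 : (0 : ℝ) ≤ r := Nat.cast_nonneg r
    have hzy : |z * y| < 1 := by
      rw [abs_lt]; constructor <;> nlinarith [Real.goldenRatio_sq]
    have hy : |r * y| < 1 := by
      rw [abs_mul, abs_of_nonneg (by linarith)] at hzy
      rw [abs_mul, abs_of_nonneg h0]
      nlinarith [abs_nonneg y]
    rw [abs_lt] at hy
    simp only [window, Set.mem_ofPred_eq]
    rw [mul_left_comm]
    exact ⟨hy.1, hy.2.trans h6⟩
  rw [← conj_mem_window, (shift_one_mul (window_anti hm hx)).2]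
  exact hx

/-! ### Fibonacci splitting of block sums -/

/-- The sum of `g` over the `fib k` consecutive integers starting at `h`. -/
def blockSum (g : ℕ → ℝ) (k h : ℕ) : ℝ := ∑ l ∈ range (Nat.fib k), g (h + l)

theorem sum_range_split (g : ℕ → ℝ) (h a b : ℕ) :
    ∑ l ∈ range (a + b), g (h + l) =
      ∑ l ∈ range a, g (h + l) + ∑ l ∈ range b, g (h + a + l) := by
  rw [sum_range_add]
  simp only [add_assoc]

theorem blockSum_add_two (g : ℕ → ℝ) (k h : ℕ) :
    blockSum g (k + 2) h = blockSum g (k + 1) h + blockSum g k (h + Nat.fib (k + 1)) := by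
  rw [blockSum, Nat.fib_add_two, add_comm (Nat.fib k), sum_range_split]
  rfl

theorem indices_add_fib_ge {k h : ℕ} (hk : 1 ≤ k) (hh : ∀ i ∈ indices h, k + 3 ≤ i) :
    ∀ i ∈ indices (h + Nat.fib (k + 1)), k + 1 ≤ i := by
  have hlt : Nat.fib (k + 1) < Nat.fib (k + 2) := Nat.fib_lt_fib_succ (by omega)
  rw [(indices_add hh hlt).1, indices_fib (by omega)]
  intro i hi
  rcases mem_union.1 hi with hi | hi
  · have := hh i hi; omega
  · simp at hi; omega

/-- Iterating the recursion cuts the block into `fib (i + 1)` pieces of length `fib (j + 1)` and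
`fib i` pieces of length `fib j`. -/
theorem abs_blockSum_le {g : ℕ → ℝ} {j : ℕ} {a₀ a₁ : ℝ} (hj : 1 ≤ j)
    (h₀ : ∀ h, (∀ i ∈ indices h, j + 1 ≤ i) → |blockSum g j h| ≤ a₀)
    (h₁ : ∀ h, (∀ i ∈ indices h, j + 2 ≤ i) → |blockSum g (j + 1) h| ≤ a₁) :
    ∀ (i h : ℕ), (∀ x ∈ indices h, j + 1 + i + 1 ≤ x) →
    |blockSum g (j + 1 + i) h| ≤ Nat.fib (i + 1) * a₁ + Nat.fib i * a₀
  | 0, h, hh => by simpa using h₁ h hh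
  | 1, h, hh => by
    have e : blockSum g (j + 1 + 1) h = _ := blockSum_add_two g j h
    rw [e]
    refine (abs_add_le _ _).trans ?_
    have := h₁ h fun x hx => by have := hh x hx; omega
    have := h₀ _ (indices_add_fib_ge hj hh)
    simp; linarith
  | i + 2, h, hh => by
    have e : blockSum g (j + 1 + (i + 2)) h = _ := blockSum_add_two g (j + 1 + i) h
    rw [e]
    refine (abs_add_le _ _).trans ?_
    have b1 := abs_blockSum_le hj h₀ h₁ (i + 1) h fun x hx => by have := hh x hx; omega
    have b2 := abs_blockSum_le hj h₀ h₁ i _ (indices_add_fib_ge (k := j + 1 + i) (by omega) hh)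
    have e1 : (Nat.fib (i + 2 + 1) : ℝ) = Nat.fib (i + 1) + Nat.fib (i + 1 + 1) := by
      exact_mod_cast Nat.fib_add_two (n := i + 1)
    have e2 : (Nat.fib (i + 1 + 1) : ℝ) = Nat.fib i + Nat.fib (i + 1) := by
      exact_mod_cast Nat.fib_add_two (n := i)
    rw [e1, e2]
    rw [e2, ← add_assoc (j + 1)] at b1
    linarith

/-- The long pieces of this splitting start at `h` plus a sparse sum with indices at least `j + 2`.
Setting one of them aside saves one `a₁`. -/
theorem abs_blockSum_sub_le {g : ℕ → ℝ} {j : ℕ} {a₀ a₁ : ℝ} (hj : 1 ≤ j)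
    (h₀ : ∀ h, (∀ i ∈ indices h, j + 1 ≤ i) → |blockSum g j h| ≤ a₀)
    (h₁ : ∀ h, (∀ i ∈ indices h, j + 2 ≤ i) → |blockSum g (j + 1) h| ≤ a₁) :
    ∀ (i h : ℕ) (s : Finset ℕ), IsSparse s →
    (∀ x ∈ s, j + 2 ≤ x ∧ x < j + 1 + i) → (∀ x ∈ indices h, j + 1 + i + 1 ≤ x) →
    |blockSum g (j + 1 + i) h - blockSum g (j + 1) (h + ∑ x ∈ s, Nat.fib x)| ≤
      Nat.fib (i + 1) * a₁ + Nat.fib i * a₀ - a₁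
  | 0, h, s, _, hs', _ => by
    obtain rfl : s = ∅ := eq_empty_of_forall_notMem fun x hx => by have := hs' x hx; omega
    simp
  | 1, h, s, _, hs', hh => by
    obtain rfl : s = ∅ := eq_empty_of_forall_notMem fun x hx => by have := hs' x hx; omega
    have e : blockSum g (j + 1 + 1) h = _ := blockSum_add_two g j h
    have := h₀ _ (indices_add_fib_ge hj hh)
    rw [e]
    simpa using this
  | i + 2, h, s, hs, hs', hh => by
    have e : blockSum g (j + 1 + (i + 2)) h = _ := blockSum_add_two g (j + 1 + i) h
    have hh1 : ∀ x ∈ indices h, j + 1 + (i + 1) + 1 ≤ x := fun x hx => by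
      have := hh x hx; omega
    have hh2 := indices_add_fib_ge (k := j + 1 + i) (by omega) hh
    have e1 : (Nat.fib (i + 2 + 1) : ℝ) = Nat.fib (i + 1) + Nat.fib (i + 1 + 1) := by
      exact_mod_cast Nat.fib_add_two (n := i + 1)
    have e2 : (Nat.fib (i + 1 + 1) : ℝ) = Nat.fib i + Nat.fib (i + 1) := by
      exact_mod_cast Nat.fib_add_two (n := i)
    rw [e, e1, e2]
    -- The second half starts at `h + fib (j + 1 + i + 1)`, so this top index tells which half
    -- contains the chosen piece.
    by_cases hT : j + 1 + i + 1 ∈ s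
    · have b1 := abs_blockSum_le hj h₀ h₁ (i + 1) h hh1
      have b2 := abs_blockSum_sub_le hj h₀ h₁ i _ (s.erase (j + 1 + i + 1)) (hs.mono (erase_subset _ _))
        (fun x hx => by
          obtain ⟨hne, hx⟩ := mem_erase.1 hx
          have h1 := hs' x hx
          have h2 : x ≠ j + 1 + i := fun h => (hs x hx).2 (h ▸ hT)
          omega) hh2
      rw [add_assoc h, add_sum_erase s Nat.fib hT] at b2
      rw [add_sub_assoc]
      refine (abs_add_le _ _).trans ?_
      rw [e2, ← add_assoc (j + 1)] at b1
      linarith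
    · have b1 := abs_blockSum_sub_le hj h₀ h₁ (i + 1) h s hs (fun x hx => by
        have h1 := hs' x hx
        have h2 : x ≠ j + 1 + i + 1 := fun h => hT (h ▸ hx)
        omega) hh1
      have b2 := abs_blockSum_le hj h₀ h₁ i _ hh2
      rw [add_sub_right_comm]
      refine (abs_add_le _ _).trans ?_
      rw [e2, ← add_assoc (j + 1)] at b1
      linarith

/-- Nonemptiness of `s` makes the two pieces set aside distinct, so `a₁` is saved twice; the
recursion descends until they fall into different halves. -/
theorem abs_blockSum_sub_sub_le {g : ℕ → ℝ} {j : ℕ} {a₀ a₁ : ℝ} (hj : 1 ≤ j)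
    (h₀ : ∀ h, (∀ i ∈ indices h, j + 1 ≤ i) → |blockSum g j h| ≤ a₀)
    (h₁ : ∀ h, (∀ i ∈ indices h, j + 2 ≤ i) → |blockSum g (j + 1) h| ≤ a₁) :
    ∀ (i h : ℕ) (s : Finset ℕ), IsSparse s → s.Nonempty →
    (∀ x ∈ s, j + 2 ≤ x ∧ x < j + 1 + i) → (∀ x ∈ indices h, j + 1 + i + 1 ≤ x) →
    |blockSum g (j + 1 + i) h -
        (blockSum g (j + 1) h + blockSum g (j + 1) (h + ∑ x ∈ s, Nat.fib x))| ≤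
      Nat.fib (i + 1) * a₁ + Nat.fib i * a₀ - 2 * a₁
  | 0, _, _, _, ⟨x, hx⟩, hs', _ => by have := hs' x hx; omega
  | 1, _, _, _, ⟨x, hx⟩, hs', _ => by have := hs' x hx; omega
  | i + 2, h, s, hs, hne, hs', hh => by
    have e : blockSum g (j + 1 + (i + 2)) h = _ := blockSum_add_two g (j + 1 + i) h
    have hh1 : ∀ x ∈ indices h, j + 1 + (i + 1) + 1 ≤ x := fun x hx => by
      have := hh x hx; omega
    have hh2 := indices_add_fib_ge (k := j + 1 + i) (by omega) hh
    have e1 : (Nat.fib (i + 2 + 1) : ℝ) = Nat.fib (i + 1) + Nat.fib (i + 1 + 1) := by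
      exact_mod_cast Nat.fib_add_two (n := i + 1)
    have e2 : (Nat.fib (i + 1 + 1) : ℝ) = Nat.fib i + Nat.fib (i + 1) := by
      exact_mod_cast Nat.fib_add_two (n := i)
    rw [e, e1, e2]
    by_cases hT : j + 1 + i + 1 ∈ s
    · have b1 := abs_blockSum_sub_le hj h₀ h₁ (i + 1) h ∅ (by simp [IsSparse]) (by simp) hh1
      have b2 := abs_blockSum_sub_le hj h₀ h₁ i _ (s.erase (j + 1 + i + 1))
        (hs.mono (erase_subset _ _))
        (fun x hx => by
          obtain ⟨hne, hx⟩ := mem_erase.1 hx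
          have h1 := hs' x hx
          have h2 : x ≠ j + 1 + i := fun h => (hs x hx).2 (h ▸ hT)
          omega) hh2
      rw [add_assoc h, add_sum_erase s Nat.fib hT] at b2
      rw [sum_empty, add_zero] at b1
      rw [add_sub_add_comm]
      refine (abs_add_le _ _).trans ?_
      rw [e2, ← add_assoc (j + 1)] at b1
      linarith
    · have b1 := abs_blockSum_sub_sub_le hj h₀ h₁ (i + 1) h s hs hne (fun x hx => by
        have h1 := hs' x hx
        have h2 : x ≠ j + 1 + i + 1 := fun h => hT (h ▸ hx)
        omega) hh1
      have b2 := abs_blockSum_le hj h₀ h₁ i _ hh2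
      rw [add_sub_right_comm]
      refine (abs_add_le _ _).trans ?_
      rw [e2, ← add_assoc (j + 1)] at b1
      linarith

/-! ### Sign flips and exact cancellation -/

/-- A number `w` whose digit pattern, inserted into a long enough run of zeros, changes the parity
of `s_φ(p n) + s_φ(q n)`. -/
def IsFlip (p q w : ℕ) : Prop :=
  (q : ℝ) * conj w ∈ window 2 ∧ Odd (zeckendorfDigitSum (p * w) + zeckendorfDigitSum (q * w))

/-- Multiplication by `r ≤ q` spreads digits by a number of places bounded in terms of `q`. The gaps
of order `4 * q` keep the multiples of `h`, of the shifted `w` and of `l` apart, so their digit sums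
add. -/
theorem digitSum_mul_shift_add {q r w j R t h l : ℕ} (hr : r ≤ q) (hw : r * conj w ∈ window 2)
    (ht : t = j + 4 * q) (hR : shift (t + 1) w < Nat.fib (t + R))
    (hh : ∀ i ∈ indices h, t + R + 4 * q + 3 ≤ i) (hl : l < Nat.fib j) :
    zeckendorfDigitSum (r * (h + shift (t + 1) w + l)) =
      zeckendorfDigitSum (r * w) + zeckendorfDigitSum (r * (h + l)) := by
  have scale : ∀ {x m : ℕ}, x < Nat.fib m → 1 ≤ m → r * x < Nat.fib (m + 2 * q) := by
    intro x m hx hm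
    rcases Nat.eq_zero_or_pos r with rfl | hr0
    · simp; omega
    · calc r * x < r * Nat.fib m := Nat.mul_lt_mul_of_pos_left hx hr0
        _ ≤ Nat.fib (m + 2 * r) := mul_fib_le r m
        _ ≤ _ := Nat.fib_mono (by omega)
  have hj : 1 ≤ j := by
    by_contra h0
    obtain rfl : j = 0 := by omega
    simp at hl
  have hl' := scale hl hj
  have hw' := scale hR (by omega)
  have hih : ∀ i ∈ indices (r * h), t + R + 2 * q + 2 ≤ i :=
    mul_indices_ge (q := q) (by omega) hr fun i hi => by have := hh i hi; omega
  have hihw : ∀ i ∈ indices (r * (h + shift (t + 1) w)), j + 2 * q + 1 ≤ i := by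
    refine mul_indices_ge (q := q) (by omega) hr fun i hi => ?_
    have := (indices_add (m := t + R) (fun i hi => by have := hh i hi; omega) hR).1
    rw [this] at hi
    rcases mem_union.1 hi with hi | hi
    · have := hh i hi; omega
    · rw [indices_shift] at hi
      simp only [mem_map, addRightEmbedding_apply] at hi
      obtain ⟨x, hx, rfl⟩ := hi
      have := (isSparse_indices w x hx).1
      omega
  have e1 := (indices_add hihw hl').2
  have e2 := (indices_add (m := t + R + 2 * q) (fun i hi => by have := hih i hi; omega) hw').2
  have e3 := (indices_add (m := j + 2 * q) (fun i hi => by have := hih i hi; omega) hl').2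
  rw [mul_add r (h + _), e1, mul_add r h, e2, mul_add r h, e3, ← shift_mul t hw, digitSum_shift]
  ring

/-- The sign `(-1) ^ (s_φ(p n) + s_φ(q n))`. -/
def sign (p q n : ℕ) : ℝ := (-1) ^ (zeckendorfDigitSum (p * n) + zeckendorfDigitSum (q * n))

theorem abs_sign (p q n : ℕ) : |sign p q n| = 1 := by
  rw [sign, abs_pow]; simp

theorem exists_shift_lt (w : ℕ) : ∃ R, ∀ t, shift (t + 1) w < Nat.fib (t + R) := by
  refine ⟨1 + 2 * (w + shift 1 w + 1), fun t => ?_⟩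
  have h := mul_fib_le (w + shift 1 w + 1) (t + 1)
  rw [add_assoc t] at h
  refine lt_of_lt_of_le ?_ h
  rw [shift_succ]
  have h1 : Nat.fib t ≤ Nat.fib (t + 1) := Nat.fib_le_fib_succ
  have h2 : 0 < Nat.fib (t + 1) := Nat.fib_pos.2 (by omega)
  nlinarith [Nat.mul_le_mul_right w h1]

theorem exists_contraction {p q w : ℕ} (hpq : p ≤ q) (hw : IsFlip p q w) :
    ∃ L : ℕ, 1 ≤ L ∧ ∀ j : ℕ, 1 ≤ j → ∀ a₀ a₁ : ℝ,
      (∀ h, (∀ i ∈ indices h, j + 1 ≤ i) → |blockSum (sign p q) j h| ≤ a₀) →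
      (∀ h, (∀ i ∈ indices h, j + 2 ≤ i) → |blockSum (sign p q) (j + 1) h| ≤ a₁) →
      ∀ h, (∀ i ∈ indices h, j + 1 + L + 1 ≤ i) →
        |blockSum (sign p q) (j + 1 + L) h| ≤
          Nat.fib (L + 1) * a₁ + Nat.fib L * a₀ - 2 * a₁ := by
  obtain ⟨R, hR⟩ := exists_shift_lt w
  -- With `t = j + 1 + 4 * q`, the free room required is `t + R + 4 * q + 3 = j + 1 + L + 1`.
  refine ⟨R + 8 * q + 2, by omega, fun j hj a₀ a₁ h₀ h₁ h hh => ?_⟩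
  obtain ⟨hw1, hw2⟩ := hw
  have hw0 : w ≠ 0 := by
    rintro rfl
    simp [zeckendorfDigitSum_zero] at hw2
  set t := j + 1 + 4 * q with ht
  have hp : (p : ℝ) * conj w ∈ window 2 := by
    rcases Nat.eq_zero_or_pos q with rfl | hq
    · obtain rfl : p = 0 := by omega
      exact hw1
    · have := mul_mem_window hw1 (c := p / q) (by positivity)
        (div_le_one_of_le₀ (by exact_mod_cast hpq) (by positivity))
      rwa [← mul_assoc, div_mul_cancel₀ _ (by positivity)] at this
  have hflip : ∀ l < Nat.fib (j + 1),
      sign p q (h + shift (t + 1) w + l) = -sign p q (h + l) := by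
    intro l hl
    have hh' : ∀ i ∈ indices h, t + R + 4 * q + 3 ≤ i := fun i hi => by
      have := hh i hi; omega
    rw [sign, digitSum_mul_shift_add hpq hp ht (hR t) hh' hl,
      digitSum_mul_shift_add le_rfl hw1 ht (hR t) hh' hl, add_add_add_comm, pow_add, hw2.neg_one_pow,
      sign, neg_one_mul]
  have hcancel : blockSum (sign p q) (j + 1) h +
      blockSum (sign p q) (j + 1) (h + shift (t + 1) w) = 0 := by
    rw [blockSum, blockSum, ← sum_add_distrib]
    refine sum_eq_zero fun l hl => ?_
    rw [hflip l (mem_range.1 hl), add_neg_cancel]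
  have key := abs_blockSum_sub_sub_le hj h₀ h₁ (R + 8 * q + 2) h (indices (shift (t + 1) w))
    (isSparse_indices _) ?_ ?_ hh
  · rwa [sum_indices, hcancel, sub_zero] at key
  · rw [indices_shift, map_nonempty, nonempty_iff_ne_empty]
    intro he
    apply hw0
    rw [← sum_indices w, he, sum_empty]
  · intro x hx
    have h1 := lt_of_mem_indices (hR t) hx
    rw [indices_shift] at hx
    simp only [mem_map, addRightEmbedding_apply] at hx
    obtain ⟨y, hy, rfl⟩ := hx
    omega

/-! ### From contraction to a power saving -/

theorem exists_exponent (L : ℕ) : ∃ θ : ℝ, 0 < θ ∧ θ < 1 ∧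
    (Nat.fib (L + 1) - 2) * φ ^ θ + Nat.fib L ≤ (φ ^ θ) ^ (L + 1) := by
  have hc : Continuous fun θ : ℝ => φ ^ θ :=
    Real.continuous_const_rpow Real.goldenRatio_ne_zero
  have hf : Continuous fun θ : ℝ =>
      (φ ^ θ) ^ (L + 1) - ((Nat.fib (L + 1) - 2) * φ ^ θ + Nat.fib L) := by fun_prop
  -- At `θ = 1` the identity `φ ^ (L + 1) = φ * fib (L + 1) + fib L` leaves a margin of `2 * φ`;
  -- continuity then allows some `θ < 1`.
  have h1 : 0 < (φ ^ (1 : ℝ)) ^ (L + 1) -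
      ((Nat.fib (L + 1) - 2) * φ ^ (1 : ℝ) + Nat.fib L) := by
    rw [Real.rpow_one, ← Real.goldenRatio_mul_fib_succ_add_fib]
    linarith [Real.goldenRatio_pos]
  have h2 := (hf.tendsto 1).eventually (lt_mem_nhds h1)
  have h3 : ∀ᶠ θ : ℝ in nhds 1, 0 < θ := lt_mem_nhds one_pos
  obtain ⟨θ, ⟨h4, h5⟩, h6⟩ := ((h2.and h3).filter_mono nhdsWithin_le_nhds |>.and
    (self_mem_nhdsWithin (a := (1 : ℝ)) (s := Set.Iio 1))).exists
  exact ⟨θ, h5, h6, by linarith⟩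

theorem abs_sum_sign_le (p q h M : ℕ) : |∑ l ∈ range M, sign p q (h + l)| ≤ M := by
  refine (abs_sum_le_sum_abs _ _).trans ?_
  simp [abs_sign]

theorem exists_blockSum_bound {p q w : ℕ} (hpq : p ≤ q) (hw : IsFlip p q w) :
    ∃ θ C : ℝ, 0 < θ ∧ θ < 1 ∧ 0 < C ∧ ∀ k h, (∀ i ∈ indices h, k + 1 ≤ i) →
      |blockSum (sign p q) k h| ≤ C * (φ ^ θ) ^ k := by
  obtain ⟨L, hL1, hL⟩ := exists_contraction hpq hw
  obtain ⟨θ, hθ0, hθ1, hθ⟩ := exists_exponent L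
  have hρ : 1 < φ ^ θ := Real.one_lt_rpow Real.one_lt_goldenRatio hθ0
  set ρ := φ ^ θ
  -- This constant covers the trivial bound for all blocks with `k ≤ L + 1`.
  refine ⟨θ, Nat.fib (L + 1) + 1, hθ0, hθ1, by positivity, fun k => ?_⟩
  set C : ℝ := Nat.fib (L + 1) + 1
  have hC : 0 < C := by positivity
  induction k using Nat.strong_induction_on with
  | _ k ih =>
    intro h hh
    rcases le_or_gt k (L + 1) with hk | hk
    · have h1 : (Nat.fib k : ℝ) ≤ Nat.fib (L + 1) := by exact_mod_cast Nat.fib_mono hk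
      have h2 := abs_sum_sign_le p q h (Nat.fib k)
      have h3 : 1 ≤ ρ ^ k := one_le_pow₀ hρ.le
      rw [blockSum]
      nlinarith
    · obtain ⟨j, rfl⟩ : ∃ j, k = j + 1 + L := ⟨k - 1 - L, by omega⟩
      have h1 := hL j (by omega) _ _ (ih j (by omega)) (ih (j + 1) (by omega)) h hh
      refine h1.trans ?_
      have h2 := mul_le_mul_of_nonneg_left hθ (show 0 ≤ C * ρ ^ j by positivity)
      calc _ = C * ρ ^ j * ((Nat.fib (L + 1) - 2) * ρ + Nat.fib L) := by ring
        _ ≤ _ := h2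
        _ = _ := by ring

/-- Greedy decomposition: a full block is split off and the remainder fits two levels lower. The
condition `hCD` makes the resulting geometric series close up. -/
theorem abs_partial_sum_le {p q : ℕ} {ρ C D : ℝ} (hρ : 1 ≤ ρ) (hD : 1 ≤ D)
    (hCD : C * ρ + D ≤ D * ρ ^ 2)
    (hC : ∀ k h, (∀ i ∈ indices h, k + 1 ≤ i) → |blockSum (sign p q) k h| ≤ C * ρ ^ k) :
    ∀ (k h M : ℕ), (∀ i ∈ indices h, k + 1 ≤ i) → M ≤ Nat.fib k →
      |∑ l ∈ range M, sign p q (h + l)| ≤ D * ρ ^ k := by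
  have small : ∀ k h M : ℕ, M ≤ 1 → |∑ l ∈ range M, sign p q (h + l)| ≤ D * ρ ^ k := by
    intro k h M hM
    have h1 := abs_sum_sign_le p q h M
    have h2 : (M : ℝ) ≤ 1 := by exact_mod_cast hM
    have h3 : 1 ≤ ρ ^ k := one_le_pow₀ hρ
    nlinarith
  intro k
  induction k using Nat.strong_induction_on with
  | _ k ih =>
    match k, ih with
    | 0, _ => exact fun h M _ hM => small _ _ _ (by simp at hM; omega)
    | 1, _ => exact fun h M _ hM => small _ _ _ (by simpa using hM)
    | 2, _ => exact fun h M _ hM => small _ _ _ (by simpa using hM)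
    | k + 3, ih =>
      intro h M hh hM
      have hh' : ∀ i ∈ indices h, k + 2 + 1 ≤ i := fun i hi => by have := hh i hi; omega
      rcases le_total M (Nat.fib (k + 2)) with hM' | hM'
      · refine (ih (k + 2) (by omega) h M hh' hM').trans ?_
        exact mul_le_mul_of_nonneg_left (pow_le_pow_right₀ hρ (by omega)) (by linarith)
      · obtain ⟨M', rfl⟩ := Nat.exists_eq_add_of_le hM'
        have e : Nat.fib (k + 3) = Nat.fib (k + 1) + Nat.fib (k + 2) := Nat.fib_add_two
        have h1 := hC (k + 2) h hh'
        have h2 := ih (k + 1) (by omega) (h + Nat.fib (k + 2)) M'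
          (indices_add_fib_ge (k := k + 1) (by omega) hh) (by omega)
        rw [sum_range_split]
        refine (abs_add_le _ _).trans ((add_le_add h1 h2).trans ?_)
        have h3 := mul_le_mul_of_nonneg_left hCD (show 0 ≤ ρ ^ (k + 1) by positivity)
        calc _ = ρ ^ (k + 1) * (C * ρ + D) := by ring
          _ ≤ _ := h3
          _ = _ := by ring

theorem goldenRatio_pow_le (n : ℕ) : φ ^ (n + 2) ≤ 6 * Nat.fib (n + 1) := by
  have h1 := Real.goldenRatio_mul_fib_succ_add_fib n
  have h2 : (Nat.fib n : ℝ) ≤ Nat.fib (n + 1) := by exact_mod_cast Nat.fib_le_fib_succ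
  have h3 := Real.goldenRatio_lt_two
  have h4 := Real.goldenRatio_pos
  have h5 : φ ^ (n + 1) ≤ 3 * Nat.fib (n + 1) := by
    rw [← h1]; nlinarith [(Nat.cast_nonneg (Nat.fib (n + 1)) : (0 : ℝ) ≤ _)]
  rw [pow_succ]
  nlinarith [pow_pos h4 (n + 1)]

theorem isBigO_sum_sign {p q w : ℕ} (hpq : p ≤ q) (hw : IsFlip p q w) :
    ∃ η : ℝ, 0 < η ∧ (fun N : ℕ => ∑ n ∈ Ico 1 N, sign p q n)
      =O[Filter.atTop] (fun N : ℕ => (N : ℝ) ^ (1 - η)) := by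
  obtain ⟨θ, C, hθ0, hθ1, hC0, hC⟩ := exists_blockSum_bound hpq hw
  refine ⟨1 - θ, by linarith, ?_⟩
  rw [sub_sub_cancel]
  have hρ : 1 < φ ^ θ := Real.one_lt_rpow Real.one_lt_goldenRatio hθ0
  set ρ := φ ^ θ with hρdef
  have hρ2 : 0 < ρ ^ 2 - 1 := by nlinarith
  set D := C * ρ / (ρ ^ 2 - 1) + 1 with hDdef
  have hD : 1 ≤ D := by
    have : 0 ≤ C * ρ / (ρ ^ 2 - 1) := by positivity
    linarith
  have hCD : C * ρ + D ≤ D * ρ ^ 2 := by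
    have : D * (ρ ^ 2 - 1) = C * ρ + (ρ ^ 2 - 1) := by
      rw [hDdef, add_mul, div_mul_cancel₀ _ hρ2.ne', one_mul]
    linarith
  -- The extra `1` pays for the term `n = 0`, which the range sum includes.
  refine Asymptotics.IsBigO.of_bound (D * 6 ^ θ + 1) ?_
  filter_upwards [Filter.eventually_ge_atTop 1] with N hN
  have hN1 : (1 : ℝ) ≤ N := by exact_mod_cast hN
  have hNθ : 1 ≤ (N : ℝ) ^ θ := Real.one_le_rpow hN1 hθ0.le
  rw [Real.norm_eq_abs, Real.norm_of_nonneg (by positivity)]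
  obtain ⟨k, hk⟩ : ∃ k, Nat.greatestFib N = k + 1 :=
    Nat.exists_eq_succ_of_ne_zero (Nat.greatestFib_ne_zero.2 (by omega))
  have hk1 : Nat.fib (k + 1) ≤ N := hk ▸ Nat.fib_greatestFib_le N
  have hk2 : N < Nat.fib (k + 2) := by
    have := Nat.lt_fib_greatestFib_add_one N
    rwa [hk] at this
  have hempty : ∀ i ∈ indices 0, k + 2 + 1 ≤ i := by simp [indices]
  have h1 := abs_partial_sum_le hρ.le hD hCD hC (k + 2) 0 N hempty hk2.le
  simp only [zero_add] at h1
  have h2 : ρ ^ (k + 2) ≤ 6 ^ θ * (N : ℝ) ^ θ := by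
    rw [hρdef, Real.rpow_pow_comm (by positivity), ← Real.mul_rpow (by norm_num) (by positivity)]
    refine Real.rpow_le_rpow (by positivity) ((goldenRatio_pow_le k).trans ?_) hθ0.le
    have : (Nat.fib (k + 1) : ℝ) ≤ N := by exact_mod_cast hk1
    linarith
  have h3 : ∑ n ∈ Ico 1 N, sign p q n = ∑ n ∈ range N, sign p q n - sign p q 0 := by
    rw [range_eq_Ico, sum_eq_sum_Ico_succ_bot (show 0 < N by omega)]
    ring
  rw [h3]
  have h4 := abs_sub (∑ n ∈ range N, sign p q n) (sign p q 0)
  rw [abs_sign] at h4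
  have h5 : D * ρ ^ (k + 2) ≤ D * (6 ^ θ * (N : ℝ) ^ θ) := by gcongr
  linarith

/-! ### Construction of a sign-flipping pattern -/

theorem exists_fib_period (q B : ℕ) (hq : 0 < q) : ∃ P, B ≤ P ∧ Even P ∧
    ∀ c n, (Nat.fib (n + P * c) : ZMod q) = Nat.fib n := by
  have : NeZero q := ⟨hq.ne'⟩
  let σ : Equiv.Perm (ZMod q × ZMod q) :=
    { toFun := fun x => (x.2, x.1 + x.2)
      invFun := fun x => (x.2 - x.1, x.1)
      left_inv := fun x => by simp
      right_inv := fun x => by simp }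
  have hσ : ∀ m n : ℕ, (σ ^ m) ((Nat.fib n : ZMod q), (Nat.fib (n + 1) : ZMod q)) =
      ((Nat.fib (n + m) : ZMod q), (Nat.fib (n + m + 1) : ZMod q)) := by
    intro m n
    induction m with
    | zero => simp
    | succ m ih =>
      rw [pow_succ', Equiv.Perm.mul_apply, ih]
      change (_, _) = _
      rw [← add_assoc n, Nat.fib_add_two (n := n + m), Nat.cast_add]
  have hpos : 0 < orderOf σ := orderOf_pos σ
  -- Every multiple of the order is a period; the factor `2 * B` makes it even and at least `B`.
  refine ⟨orderOf σ * (2 * B), by nlinarith, ⟨orderOf σ * B, by ring⟩, fun c n => ?_⟩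
  have h := hσ (orderOf σ * (2 * B) * c) n
  rw [mul_assoc, pow_mul, pow_orderOf_eq_one, one_pow, Equiv.Perm.one_apply] at h
  rw [mul_assoc]
  exact (congrArg Prod.fst h).symm

theorem disjoint_of_separated {s t : Finset ℕ} {m : ℕ}
    (hsm : ∀ i ∈ s, m ≤ i) (htm : ∀ i ∈ t, i + 2 ≤ m) : Disjoint s t :=
  disjoint_left.2 fun i h1 h2 => by have := hsm i h1; have := htm i h2; omega

theorem isSparse_singleton {k : ℕ} (hk : 2 ≤ k) : IsSparse {k} := fun i hi => by
  simp at hi ⊢; omega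

/-- The arithmetic progression `a, a + d, …, a + (n - 1) d`. -/
def progression (a d n : ℕ) : Finset ℕ := (range n).image fun i => a + d * i

theorem progression_bounds {a d n x : ℕ} (hx : x ∈ progression a d n) :
    a ≤ x ∧ x + d ≤ a + d * n := by
  simp only [progression, mem_image, mem_range] at hx
  obtain ⟨i, hi, rfl⟩ := hx
  have : d * (i + 1) ≤ d * n := Nat.mul_le_mul_left d hi
  rw [mul_add, mul_one] at this
  omega

theorem isSparse_progression {a d : ℕ} (n : ℕ) (ha : 2 ≤ a) (hd : 2 ≤ d) :
    IsSparse (progression a d n) := by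
  intro x hx
  refine ⟨ha.trans (progression_bounds hx).1, fun hx' => ?_⟩
  simp only [progression, mem_image, mem_range] at hx hx'
  obtain ⟨i, -, rfl⟩ := hx
  obtain ⟨j, -, hj⟩ := hx'
  have h1 : d * j = d * i + 1 := by omega
  have h2 : d ∣ 1 := (Nat.dvd_add_right (dvd_mul_right d i)).1 (h1 ▸ dvd_mul_right d j)
  have := Nat.le_of_dvd one_pos h2
  omega

theorem progression_injective {a d : ℕ} (hd : 2 ≤ d) :
    Function.Injective fun i : ℕ => a + d * i := by
  intro i j h
  exact Nat.eq_of_mul_eq_mul_left (by omega) (Nat.add_left_cancel h)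

theorem card_progression {a d : ℕ} (n : ℕ) (hd : 2 ≤ d) : (progression a d n).card = n := by
  rw [progression, card_image_of_injective _ (progression_injective hd), card_range]

/-- The general codomain lets the same digit sets be summed over Fibonacci numbers and over powers
of `ψ`. -/
theorem sum_progression {M : Type*} [AddCommMonoid M] (f : ℕ → M) {a d : ℕ} (n : ℕ) (hd : 2 ≤ d) :
    ∑ x ∈ progression a d n, f x = ∑ i ∈ range n, f (a + d * i) := by
  rw [progression, sum_image fun _ _ _ _ h => progression_injective hd h]

/-- This is the chain of carries: one extra term at `k + 1` collapses the whole run `k + 2, k + 4,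
…` into a single term. -/
theorem sum_progression_two {M : Type*} [AddCommMonoid M] {f : ℕ → M}
    (hf : ∀ n, f (n + 2) = f n + f (n + 1)) (k n : ℕ) :
    f (k + 1) + ∑ x ∈ progression (k + 2) 2 n, f x = f (k + 2 * n + 1) := by
  rw [sum_progression f n le_rfl]
  induction n with
  | zero => simp
  | succ n ih =>
    rw [sum_range_succ, ← add_assoc, ih, show k + 2 * (n + 1) + 1 = k + 2 * n + 1 + 2 by ring, hf,
      show k + 2 + 2 * n = k + 2 * n + 1 + 1 by ring]

/-- Divisibility of the sum and of its shift gives `∑ ψ ^ i = q * (t - φ n)` with integers `n`, `t`.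
Dividing by `q` stays in `window 2`, which forces `t = shift 1 n`. -/
theorem exists_quotient {q : ℕ} (hq : 0 < q) {s : Finset ℕ} (hs : IsSparse s)
    (h0 : ((∑ i ∈ s, Nat.fib i : ℕ) : ZMod q) = 0)
    (h1 : ((∑ i ∈ s, Nat.fib (i + 1) : ℕ) : ZMod q) = 0) :
    ∃ n, q * n = ∑ i ∈ s, Nat.fib i ∧ q * conj n = ∑ i ∈ s, ψ ^ i ∧ q * conj n ∈ window 2 := by
  obtain ⟨n, hn⟩ := (ZMod.natCast_eq_zero_iff _ _).1 h0
  obtain ⟨t, ht⟩ := (ZMod.natCast_eq_zero_iff _ _).1 h1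
  have hw : (∑ i ∈ s, ψ ^ i) ∈ window 2 := (sum_pow_mem_window hs).2 fun i hi => (hs i hi).1
  have e : ∑ i ∈ s, ψ ^ i = q * ((t : ℝ) - φ * n) := by
    have h2 := conj_eq (∑ i ∈ s, Nat.fib i)
    rw [conj, shift, indices_sum hs, hn, ht] at h2
    rw [h2]; push_cast; ring
  have hq' : (0 : ℝ) < q := by exact_mod_cast hq
  have h3 : (t : ℝ) - φ * n ∈ window 2 := by
    have h4 := mul_mem_window hw (c := 1 / q) (by positivity)
      (div_le_one_of_le₀ (by exact_mod_cast hq) hq'.le)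
    rwa [e, ← mul_assoc, one_div_mul_cancel hq'.ne', one_mul] at h4
  have h5 : (q : ℝ) * conj n = ∑ i ∈ s, ψ ^ i := by
    rw [conj_eq, shift_one_eq_of_mem_window h3, e]
  exact ⟨n, hn.symm, h5, h5 ▸ hw⟩

/-- At the scale of `window (k + 1)`, `X` equals `φ` plus a positive error below `2 / φ ^ (2 * P)`,
so it lies just beyond the right end `φ`. The factor `p / q < 1` brings it back inside. -/
theorem mul_mem_window_of_eq {p q P k : ℕ} {x X Z : ℝ} (hpq : p < q) (hP : 2 * q ≤ P)
    (hx : q * x = X) (hX : X + ψ ^ k = ψ ^ (k + 2 * P + 1) + Z)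
    (hZ : Z ∈ window (k + 2 * P + 3)) : p * x ∈ window (k + 1) := by
  have e1 : (-φ) ^ (k + 1) * ψ ^ k = -φ := by
    rw [pow_succ, mul_right_comm, neg_goldenRatio_pow_mul, one_mul]
  have e2 : (-φ) ^ (k + 1) * ψ ^ (k + 2 * P + 1) = ψ ^ (2 * P) := by
    rw [show k + 2 * P + 1 = k + 1 + 2 * P by ring, pow_add ψ, ← mul_assoc,
      neg_goldenRatio_pow_mul, one_mul]
  have e3 : φ ^ (2 * P) * ψ ^ (2 * P) = 1 := by
    rw [← neg_goldenRatio_pow_mul (2 * P), (even_two_mul P).neg_pow]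
  obtain ⟨hZ1, hZ2⟩ := hZ
  have e4 : (-φ) ^ (k + 2 * P + 3) * Z = φ ^ 2 * (φ ^ (2 * P) * ((-φ) ^ (k + 1) * Z)) := by
    rw [show k + 2 * P + 3 = k + 1 + 2 + 2 * P by ring, pow_add, pow_add _ (k + 1),
      (even_two_mul P).neg_pow, neg_sq]
    ring
  rw [e4, Real.goldenRatio_sq] at hZ1 hZ2
  have hY : (-φ) ^ (k + 1) * X = φ + ψ ^ (2 * P) + (-φ) ^ (k + 1) * Z := by
    have : X = ψ ^ (k + 2 * P + 1) + Z - ψ ^ k := by linarith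
    rw [this, mul_sub, mul_add, e1, e2]; ring
  have h1 := Real.one_lt_goldenRatio
  have hΦ := le_goldenRatio_pow P
  set V := (-φ) ^ (k + 1) * Z
  set Φ := φ ^ (2 * P)
  set Y := ψ ^ (2 * P)
  have hPq : (2 : ℝ) * q ≤ P := by exact_mod_cast hP
  have hp1 : (p : ℝ) + 1 ≤ q := by exact_mod_cast hpq
  have hp0 : (0 : ℝ) ≤ p := Nat.cast_nonneg p
  have hΦ0 : 0 < Φ := by linarith
  have hV1 : -1 < Φ * V := by nlinarith
  have hV2 : Φ * V < 1 := by nlinarith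
  have hs1 : 0 < Y + V := by
    by_contra hneg
    nlinarith
  have hs2 : p * (Y + V) < 1 := by
    have h2 : Φ * (p * (Y + V)) ≤ 2 * p := by nlinarith
    by_contra hneg
    nlinarith
  have hq0 : (0 : ℝ) < q := by linarith
  have hfin : q * ((-φ) ^ (k + 1) * (p * x)) = p * (φ + (Y + V)) := by
    rw [← add_assoc, ← hY, ← hx]; ring
  constructor
  · have : 0 ≤ p * (φ + (Y + V)) := by positivity
    by_contra hneg
    nlinarith
  · by_contra hneg
    nlinarith

/-- With `k = P * q` and `e = k - 1`, `qa` has the digits `P, 2P, …, qP`, and `qb` has `e`, the run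
`k + 2, …, k + 2P`, and a high progression. In each of these progressions (the high one together
with `e`) the `q` terms are congruent modulo `q`, and the run sums to `0`. In `qa + qb`, `F_e + F_k
= F_{k+1}` collapses the run to `F_{k+2P+1}`: the digit sums `q` and `q + P` become `2q - 1`. -/
theorem exists_isFlip {p q : ℕ} (hp : 1 ≤ p) (hpq : p < q) : ∃ w, IsFlip p q w := by
  -- The size of `P` gives `2 * q ≤ P` for the window estimate and `2 * p * Q < P` for the bound on
  -- `p * a`; its evenness enters the final parity count.
  obtain ⟨P, hPB, hPe, hP⟩ := exists_fib_period q (2 * q * q + 10) (by omega)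
  obtain ⟨Q, rfl⟩ : ∃ Q, q = Q + 1 := ⟨q - 1, by omega⟩
  have hPq : 2 * (Q + 1) ≤ P := by nlinarith
  obtain ⟨e, he⟩ : ∃ e, P * (Q + 1) = e + 1 := ⟨P * (Q + 1) - 1, by
    have : 0 < P * (Q + 1) := Nat.mul_pos (by omega) (by omega)
    omega⟩
  set k := e + 1 with hk
  have hPQ : P * Q + P = k := by rw [← he]; ring
  have hPQ1 : P ≤ P * Q := Nat.le_mul_of_pos_right P (by omega)
  set sa := progression P P Q
  set sm := progression (k + 2) 2 P
  set sz := progression (e + 3 * P) P Q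
  have hsa : IsSparse sa := isSparse_progression _ (by omega) (by omega)
  have hsm : IsSparse sm := isSparse_progression _ (by omega) (by omega)
  have hsz : IsSparse sz := isSparse_progression _ (by omega) (by omega)
  have hsa' : ∀ i ∈ sa, i + 2 ≤ k := fun i hi => by have := (progression_bounds hi).2; omega
  have hsm1 : ∀ i ∈ sm, k + 2 ≤ i := fun i hi => (progression_bounds hi).1
  have hsz1 : ∀ i ∈ sz, e + 3 * P ≤ i := fun i hi => (progression_bounds hi).1
  have hle : ∀ x m : ℕ, x + 2 ≤ m → ∀ i ∈ ({x} : Finset ℕ), i + 2 ≤ m := fun x m h i hi => by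
    rw [mem_singleton.1 hi]; exact h
  have hme : ∀ i ∈ sm ∪ {e}, i + 2 ≤ e + 3 * P := fun i hi => by
    rcases mem_union.1 hi with hi | hi
    · have := (progression_bounds hi).2; omega
    · rw [mem_singleton.1 hi]; omega
  have hka : ∀ i ∈ {k + 2 * P + 1} ∪ sa, i + 2 ≤ e + 3 * P := fun i hi => by
    rcases mem_union.1 hi with hi | hi
    · rw [mem_singleton.1 hi]; omega
    · have := hsa' i hi; omega
  have hkk : ∀ i ∈ ({k} : Finset ℕ), k ≤ i := by simp
  have hkP : ∀ i ∈ ({k + 2 * P + 1} : Finset ℕ), k ≤ i := by simp; omega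
  have hee := hle e (k + 2) (by omega)
  -- the three sparse sets, their sizes and their sums
  have hA : IsSparse ({k} ∪ sa) := (isSparse_singleton (by omega)).union hsa hkk hsa'
  have hB : IsSparse (sz ∪ (sm ∪ {e})) :=
    hsz.union (hsm.union (isSparse_singleton (by omega)) hsm1 hee) hsz1 hme
  have hAB : IsSparse (sz ∪ ({k + 2 * P + 1} ∪ sa)) :=
    hsz.union ((isSparse_singleton (by omega)).union hsa hkP hsa') hsz1 hka
  have dA := disjoint_of_separated hkk hsa'
  have dB1 := disjoint_of_separated hsm1 hee
  have dB := disjoint_of_separated hsz1 hme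
  have dAB1 := disjoint_of_separated hkP hsa'
  have dAB := disjoint_of_separated hsz1 hka
  have sumA : ∀ f : ℕ → ℕ, ∑ i ∈ {k} ∪ sa, f i = f k + ∑ i ∈ sa, f i := fun f => by
    rw [sum_union dA, sum_singleton]
  have sumAB : ∀ f : ℕ → ℕ, (∀ n, f (n + 2) = f n + f (n + 1)) →
      ∑ i ∈ {k} ∪ sa, f i + ∑ i ∈ sz ∪ (sm ∪ {e}), f i =
        ∑ i ∈ sz ∪ ({k + 2 * P + 1} ∪ sa), f i := fun f hf => by
    rw [sumA, sum_union dB, sum_union dB1, sum_union dAB, sum_union dAB1, sum_singleton,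
      sum_singleton, ← sum_progression_two hf, hk, hf e]
    ring
  have resa : ∀ t, ((∑ i ∈ sa, Nat.fib (i + t) : ℕ) : ZMod (Q + 1)) = Q * Nat.fib t := by
    intro t
    rw [sum_progression _ _ (by omega), Nat.cast_sum, sum_congr rfl (g := fun _ =>
      (Nat.fib t : ZMod (Q + 1))), sum_const, card_range, nsmul_eq_mul]
    intro i _
    rw [show P + P * i + t = t + P * (i + 1) by ring, hP]
  have resz : ∀ t, ((∑ i ∈ sz, Nat.fib (i + t) : ℕ) : ZMod (Q + 1)) = Q * Nat.fib (e + t) := by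
    intro t
    rw [sum_progression _ _ (by omega), Nat.cast_sum, sum_congr rfl (g := fun _ =>
      (Nat.fib (e + t) : ZMod (Q + 1))), sum_const, card_range, nsmul_eq_mul]
    intro i _
    rw [show e + 3 * P + P * i + t = e + t + P * (i + 3) by ring, hP]
  have resm : ∀ t, ((∑ i ∈ sm, Nat.fib (i + t) : ℕ) : ZMod (Q + 1)) = 0 := by
    intro t
    have h := sum_progression_two (f := fun n => Nat.fib (n + t))
      (fun n => by rw [show n + 2 + t = n + t + 2 by ring, Nat.fib_add_two,
        show n + 1 + t = n + t + 1 by ring]) k P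
    have h' := congrArg (Nat.cast : ℕ → ZMod (Q + 1)) h
    rw [Nat.cast_add, show k + 2 * P + 1 + t = k + 1 + t + P * 2 by ring, hP] at h'
    simpa using h'
  have hQ : (Q : ZMod (Q + 1)) + 1 = 0 := by exact_mod_cast ZMod.natCast_self (Q + 1)
  have hfk : ∀ t, (Nat.fib (k + t) : ZMod (Q + 1)) = Nat.fib t := fun t => by
    rw [← he, add_comm _ t, hP]
  have zA : ∀ t, ((∑ i ∈ {k} ∪ sa, Nat.fib (i + t) : ℕ) : ZMod (Q + 1)) = 0 := fun t => by
    rw [sumA fun i => Nat.fib (i + t), Nat.cast_add, resa, hfk]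
    linear_combination (Nat.fib t : ZMod (Q + 1)) * hQ
  have zB : ∀ t, ((∑ i ∈ sz ∪ (sm ∪ {e}), Nat.fib (i + t) : ℕ) : ZMod (Q + 1)) = 0 := fun t => by
    rw [sum_union dB, sum_union dB1, sum_singleton, Nat.cast_add, Nat.cast_add, resz, resm]
    linear_combination (Nat.fib (e + t) : ZMod (Q + 1)) * hQ
  have zAB : ∀ t,
      ((∑ i ∈ sz ∪ ({k + 2 * P + 1} ∪ sa), Nat.fib (i + t) : ℕ) : ZMod (Q + 1)) = 0 := fun t => by
    rw [← sumAB (fun i => Nat.fib (i + t)) (fun n => by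
      rw [show n + 2 + t = n + t + 2 by ring, Nat.fib_add_two,
        show n + 1 + t = n + t + 1 by ring]), Nat.cast_add, zA, zB, add_zero]
  obtain ⟨a, ha, -, wa⟩ := exists_quotient (by omega) hA (zA 0) (zA 1)
  obtain ⟨b, hb, cb, wb⟩ := exists_quotient (by omega) hB (zB 0) (zB 1)
  obtain ⟨c, hc, -, wc⟩ := exists_quotient (by omega) hAB (zAB 0) (zAB 1)
  obtain rfl : c = a + b := by
    refine Nat.eq_of_mul_eq_mul_left (show 0 < Q + 1 by omega) ?_
    rw [hc, mul_add, ha, hb, sumAB _ fun n => Nat.fib_add_two]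
  have da : zeckendorfDigitSum ((Q + 1) * a) = 1 + Q := by
    rw [ha, digitSum_sum hA, card_union_of_disjoint dA, card_singleton, card_progression _ (by omega)]
  have db : zeckendorfDigitSum ((Q + 1) * b) = Q + (P + 1) := by
    rw [hb, digitSum_sum hB, card_union_of_disjoint dB, card_union_of_disjoint dB1, card_singleton,
      card_progression _ (by omega), card_progression _ (by omega)]
  have dc : zeckendorfDigitSum ((Q + 1) * (a + b)) = Q + (1 + Q) := by
    rw [hc, digitSum_sum hAB, card_union_of_disjoint dAB, card_union_of_disjoint dAB1,
      card_singleton, card_progression _ (by omega), card_progression _ (by omega)]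
  -- multiplication by `p` does not let the two parts interact
  have hpb : ∀ i ∈ indices (p * b), k + 1 ≤ i := by
    have hwin : (p : ℝ) * conj b ∈ window (k + 1) := by
      refine mul_mem_window_of_eq (Z := ∑ i ∈ sz, ψ ^ i) hpq hPq cb ?_ ?_
      · have hf : ∀ n, ψ ^ (n + 2) = ψ ^ n + ψ ^ (n + 1) := fun n => by
          rw [pow_add, Real.goldenConj_sq]; ring
        rw [sum_union dB, sum_union dB1, sum_singleton, ← sum_progression_two hf, hk, hf e]
        ring
      · exact (sum_pow_mem_window hsz).2 fun i hi => by have := hsz1 i hi; omega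
    rw [← conj_mem_window, (shift_one_mul (window_anti (by omega) hwin)).2]
    exact hwin
  -- The leading digit dominates: `q * a` exceeds `fib k` by so little that `p * q * a < (p + 1) *
  -- fib k ≤ q * fib k`.
  have hpa : p * a < Nat.fib k := by
    have h1 : ∑ i ∈ sa, Nat.fib i ≤ Q * Nat.fib (P * Q) := by
      rw [← card_progression (a := P) Q (show 2 ≤ P by omega), ← smul_eq_mul]
      refine sum_le_card_nsmul _ _ _ fun i hi => Nat.fib_mono ?_
      have := (progression_bounds hi).2
      rw [card_progression _ (by omega)]
      omega
    have h2 := mul_fib_le (p * Q) (P * Q)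
    have h3 : Nat.fib (P * Q + 2 * (p * Q)) < Nat.fib k :=
      (Nat.fib_lt_fib (by omega)).2 (by nlinarith)
    rw [sumA] at ha
    have h4 : (Q + 1) * (p * a) < (Q + 1) * Nat.fib k := by
      calc (Q + 1) * (p * a) = p * ((Q + 1) * a) := by ring
        _ = p * Nat.fib k + p * ∑ i ∈ sa, Nat.fib i := by rw [ha, mul_add]
        _ ≤ p * Nat.fib k + p * (Q * Nat.fib (P * Q)) := by gcongr
        _ < p * Nat.fib k + Nat.fib k := by rw [← mul_assoc]; omega
        _ = (p + 1) * Nat.fib k := by ring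
        _ ≤ _ := Nat.mul_le_mul_right _ hpq
    exact Nat.lt_of_mul_lt_mul_left h4
  have hsum : zeckendorfDigitSum (p * (a + b)) =
      zeckendorfDigitSum (p * b) + zeckendorfDigitSum (p * a) := by
    rw [mul_add, add_comm (p * a), (indices_add hpb hpa).2]
  -- If all three were even, so would be their total. The digit sums of the multiples by `p`
  -- contribute evenly, while those by `Q + 1` contribute `(1 + Q) + (Q + P + 1) + (2 * Q + 1)`,
  -- which is odd.
  by_contra hno
  have na : ¬ Odd _ := fun h => hno ⟨a, wa, h⟩
  have nb : ¬ Odd _ := fun h => hno ⟨b, wb, h⟩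
  have nc : ¬ Odd _ := fun h => hno ⟨a + b, wc, h⟩
  rw [Nat.not_odd_iff_even, Nat.even_iff] at na nb nc
  rw [Nat.even_iff] at hPe
  omega

end Zeckendorf

theorem lemma4p2 (p q : ℕ) (hp : 1 ≤ p) (hpq : p < q) :
    ∃ η : ℝ, 0 < η ∧
      (fun N : ℕ => ∑ n ∈ Finset.Ico 1 N,
          (-1 : ℝ) ^ (zeckendorfDigitSum (p * n) + zeckendorfDigitSum (q * n)))
        =O[Filter.atTop] (fun N : ℕ => (N : ℝ) ^ (1 - η)) := by
  obtain ⟨w, hw⟩ := Zeckendorf.exists_isFlip hp hpq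
  exact Zeckendorf.isBigO_sum_sign hpq.le hw
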